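/- Let $\mathbb D$ be the open unit disk in $\mathbb C$, and write $\hat f(k)$ for the power series coefficients of $f\in\mathrm{Hol}(\mathbb D)$ at $0$. For a positive sequence $\alpha=(\alpha(k))_{k\ge 0}$ with $\lim_{k\to\infty}\alpha(k+1)/\alpha(k)=1$, let $H^2_\alpha$ be the Hilbert space of all $f\in\mathrm{Hol}(\mathbb D)$ with $\sum_{k}|\hat f(k)|^2\alpha(k)^2<\infty$, with inner product $\langle f,g\rangle_\alpha=\sum_k\hat f(k)\overline{\hat g(k)}\alpha(k)^2$, and let $M_{\alpha,z}$ be the operator of multiplication by $z$ on $H^2_\alpha$. The space $H^2_\alpha$ is called Möbius invariant if $f\circ\phi\in H^2_\alpha$ for all $f\in H^2_\alpha$ and all $\phi\in\mathrm{Aut}(\mathbb D)$, where $\mathrm{Aut}(\mathbb D)$ is the group of analytic bijections of $\mathbb D$ onto itself. For two such sequences $\alpha,\beta$, let $\mathrm{Mult}(H^2_\alpha,H^2_\beta)$ be the set of all $h\in\mathrm{Hol}(\mathbb D)$ such that $hf\in H^2_\beta$ for all $f\in H^2_\alpha$, let $M_{\alpha,\beta,h}\colon H^2_\alpha\to H^2_\beta$,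 $f\mapsto hf$, be the corresponding bounded operator, and let $$T_{\alpha,\beta,h}=\begin{pmatrix} M_{\alpha,z}^* & M_{\alpha,\beta,h}^*\\ 0 & M_{\beta,z}^*\end{pmatrix}\quad\text{on } H^2_\alpha\oplus H^2_\beta .$$ A bounded linear operator $T$ on a complex separable Hilbert space is called weakly homogeneous if $\sigma(T)\subseteq\overline{\mathbb D}$ and, for every $\phi\in\mathrm{Aut}(\mathbb D)$, the operator $\phi(T)$ (given by the analytic functional calculus, i.e. $\phi(T)=\sum_k\hat\phi(k)T^k$ in operator norm) is similar to $T$. **Proposition.** Let $\alpha,\beta$ be positive sequences with $\alpha(k+1)/\alpha(k)\to1$ and $\beta(k+1)/\beta(k)\to1$ such that $H^2_\alpha$ and $H^2_\beta$ are Möbius invariant and $$\lim_{k\to\infty}\frac{\alpha(k)}{k\,\beta(k)}=0 .$$ Let $h$ be a continuous function on $\overline{\mathbb D}$ whose restriction to $\mathbb D$ belongs to $\mathrm{Mult}(H^2_\alpha,H^2_\beta)$. If $T_{\alpha,\beta,h}$ is weakly homogeneous, then either $h(z)=0$ for every $z\in\overline{\mathbb D}$, or $h(z)\neq0$ for every $z\in\overline{\mathbb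 D}$. -/

import Mathlib

open Filter Topology Set

namespace WeightedHardy

noncomputable section

/-- The open unit disk, as a subset of `ℂ`. -/
abbrev disk : Set ℂ := Metric.ball 0 1

/-- The closed unit disk, as a subset of `ℂ`. -/
abbrev closedDisk : Set ℂ := Metric.closedBall 0 1

/-- The `k`-th power series coefficient of `f` at the origin. -/
def coeff (f : ℂ → ℂ) (k : ℕ) : ℂ := iteratedDeriv k f 0 / (k.factorial : ℂ)

/-- A weight sequence: positive, with ratios of consecutive terms tending to `1`. -/
structure Weight where
  /-- The underlying sequence. -/
  toFun : ℕ → ℝ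
  pos' : ∀ k, 0 < toFun k
  ratio' : Tendsto (fun k => toFun (k + 1) / toFun k) atTop (𝓝 1)

instance : CoeFun Weight (fun _ => ℕ → ℝ) := ⟨Weight.toFun⟩

/-- `f` is holomorphic on the open unit disk and `∑ |f̂(k)|² w(k)² < ∞`.
Only the values of `f` on the open unit disk matter. -/
def MemHardy (w : Weight) (f : ℂ → ℂ) : Prop :=
  DifferentiableOn ℂ f disk ∧ Summable fun k => ‖coeff f k‖ ^ 2 * w k ^ 2

/-! ### Power series on the disk -/

theorem hasSum_coeff {f : ℂ → ℂ} (hf : DifferentiableOn ℂ f disk) {z : ℂ} (hz : z ∈ disk) :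
    HasSum (fun k => coeff f k * z ^ k) (f z) := by
  have h := Complex.hasSum_taylorSeries_on_ball hf hz
  rw [show (fun k => coeff f k * z ^ k) =
    fun k : ℕ => (k.factorial : ℂ)⁻¹ • (z - 0) ^ k • iteratedDeriv k f 0 from ?_]
  · exact h
  funext k
  simp only [coeff, sub_zero, smul_eq_mul, div_eq_mul_inv]
  ring

theorem coeff_unique {f : ℂ → ℂ} {a : ℕ → ℂ} (hf : DifferentiableOn ℂ f disk)
    (h : ∀ z ∈ disk, HasSum (fun k => a k * z ^ k) (f z)) : coeff f = a := by
  have key : ∀ b : ℕ → ℂ, (∀ z ∈ disk, HasSum (fun k => b k * z ^ k) (f z)) →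
      HasFPowerSeriesAt f (FormalMultilinearSeries.ofScalars ℂ b) 0 := by
    intro b hb
    rw [hasFPowerSeriesAt_iff]
    filter_upwards [Metric.ball_mem_nhds (0 : ℂ) one_pos] with z hz
    simpa [FormalMultilinearSeries.coeff_ofScalars, mul_comm] using hb z hz
  have h1 := key a h
  have h2 := key (coeff f) fun z hz => hasSum_coeff hf hz
  funext k
  simpa [FormalMultilinearSeries.coeff_ofScalars] using
    congrArg (fun p => FormalMultilinearSeries.coeff p k) (h2.eq_formalMultilinearSeries h1)

theorem coeff_add {f g : ℂ → ℂ} (hf : DifferentiableOn ℂ f disk)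
    (hg : DifferentiableOn ℂ g disk) (k : ℕ) :
    coeff (f + g) k = coeff f k + coeff g k :=
  congrFun (coeff_unique (a := fun k => coeff f k + coeff g k) (hf.add hg) fun z hz => by
    simpa [add_mul] using (hasSum_coeff hf hz).add (hasSum_coeff hg hz)) k

theorem coeff_smul {f : ℂ → ℂ} (c : ℂ) (hf : DifferentiableOn ℂ f disk) (k : ℕ) :
    coeff (c • f) k = c * coeff f k :=
  congrFun (coeff_unique (a := fun k => c * coeff f k) (hf.const_smul c) fun z hz => by
    simpa [mul_assoc] using (hasSum_coeff hf hz).mul_left c) k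

theorem coeff_zero (k : ℕ) : coeff 0 k = 0 :=
  congrFun (coeff_unique (f := 0) (a := fun _ => 0) (differentiableOn_const 0)
    fun z _ => by simp) k

theorem summable_pow_div (w : Weight) {r : ℝ} (h0 : 0 ≤ r) (h1 : r < 1) :
    Summable fun k => r ^ k / w k := by
  rcases h0.eq_or_lt with rfl | h0
  · refine summable_of_ne_finset_zero (s := {0}) fun k hk => ?_
    simp only [Finset.mem_singleton] at hk
    simp [hk]
  refine summable_of_ratio_test_tendsto_lt_one h1
    (Eventually.of_forall fun k => (div_pos (pow_pos h0 k) (w.pos' k)).ne') ?_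
  have h : Tendsto (fun k => r * (w (k + 1) / w k)⁻¹) atTop (𝓝 r) := by
    simpa using (w.ratio'.inv₀ one_ne_zero).const_mul r
  refine h.congr fun k => ?_
  have hk := w.pos' k
  have hk1 := w.pos' (k + 1)
  rw [Real.norm_of_nonneg (div_pos (pow_pos h0 _) hk1).le,
    Real.norm_of_nonneg (div_pos (pow_pos h0 _) hk).le, pow_succ]
  field_simp

theorem memHardy_of_coeffs (w : Weight) {a : ℕ → ℂ}
    (ha : Summable fun k => ‖a k‖ ^ 2 * w k ^ 2) :
    ∃ f : ℂ → ℂ, MemHardy w f ∧ (∀ z ∉ disk, f z = 0) ∧ coeff f = a := by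
  obtain ⟨C, hC0, hC⟩ : ∃ C : ℝ, 0 ≤ C ∧ ∀ k, ‖a k‖ ≤ C / w k := by
    refine ⟨√(∑' k, ‖a k‖ ^ 2 * w k ^ 2), Real.sqrt_nonneg _, fun k => ?_⟩
    rw [le_div_iff₀ (w.pos' k)]
    refine Real.le_sqrt_of_sq_le ?_
    rw [mul_pow]
    exact ha.le_tsum k fun j _ => by positivity
  have hsum : ∀ r : ℝ, 0 ≤ r → r < 1 → Summable fun k => C / w k * r ^ k := by
    intro r h0 h1
    refine ((summable_pow_div w h0 h1).mul_left C).congr fun k => ?_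
    ring
  have hbd : ∀ r : ℝ, ∀ k, ∀ z ∈ Metric.ball (0 : ℂ) r, ‖a k * z ^ k‖ ≤ C / w k * r ^ k := by
    intro r k z hz
    rw [mem_ball_zero_iff] at hz
    rw [norm_mul, norm_pow]
    exact mul_le_mul (hC k) (pow_le_pow_left₀ (norm_nonneg _) hz.le k) (by positivity)
      (div_nonneg hC0 (w.pos' k).le)
  have hdisk : ∀ z ∈ disk, ∃ r : ℝ, 0 ≤ r ∧ r < 1 ∧ z ∈ Metric.ball (0 : ℂ) r := by
    intro z hz
    rw [mem_ball_zero_iff] at hz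
    obtain ⟨r, hr, hr1⟩ := exists_between hz
    exact ⟨r, (norm_nonneg z).trans hr.le, hr1, by simpa using hr⟩
  set F : ℂ → ℂ := fun z => ∑' k, a k * z ^ k with hF
  have hFd : DifferentiableOn ℂ F disk := by
    intro z hz
    obtain ⟨r, h0, h1, hzr⟩ := hdisk z hz
    have := Complex.differentiableOn_tsum_of_summable_norm (F := fun k z => a k * z ^ k)
      (hsum r h0 h1) (fun k => by fun_prop) Metric.isOpen_ball (hbd r)
    exact (this.differentiableAt (Metric.isOpen_ball.mem_nhds hzr)).differentiableWithinAt
  have heq : EqOn (disk.indicator F) F disk := fun z hz => indicator_of_mem hz F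
  have hfd : DifferentiableOn ℂ (disk.indicator F) disk := hFd.congr heq
  have hc : coeff (disk.indicator F) = a := by
    refine coeff_unique hfd fun z hz => ?_
    rw [heq hz]
    obtain ⟨r, h0, h1, hzr⟩ := hdisk z hz
    exact (Summable.of_norm_bounded (hsum r h0 h1) fun k => hbd r k z hzr).hasSum
  exact ⟨disk.indicator F, ⟨hfd, by simpa [hc] using ha⟩,
    fun z hz => indicator_of_notMem hz F, hc⟩

/-! ### The Hilbert space -/

theorem memℓp_coeff {w : Weight} {f : ℂ → ℂ} (hf : MemHardy w f) :
    Memℓp (fun k => coeff f k * (w k : ℂ)) 2 := by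
  refine memℓp_gen (hf.2.congr fun k => ?_)
  simp [mul_pow, sq_abs]

theorem memHardy_of_memℓp {w : Weight} {f : ℂ → ℂ} (hd : DifferentiableOn ℂ f disk)
    (hf : Memℓp (fun k => coeff f k * (w k : ℂ)) 2) : MemHardy w f := by
  refine ⟨hd, (hf.summable (by norm_num)).congr fun k => ?_⟩
  simp [mul_pow, sq_abs]

/-- The functions in the weighted Hardy space; a function on the open unit disk is represented
by its extension by `0` to `ℂ`. -/
def hardySubmodule (w : Weight) : Submodule ℂ (ℂ → ℂ) where
  carrier := {f | MemHardy w f ∧ ∀ z ∉ disk, f z = 0}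
  zero_mem' := ⟨⟨differentiableOn_const 0, by simp [coeff_zero]⟩,
    fun _ _ => rfl⟩
  add_mem' := by
    rintro f g ⟨hf, hf0⟩ ⟨hg, hg0⟩
    refine ⟨memHardy_of_memℓp (hf.1.add hg.1) ?_, fun z hz => by simp [hf0 z hz, hg0 z hz]⟩
    convert (memℓp_coeff hf).add (memℓp_coeff hg) using 1
    funext k
    simp [coeff_add hf.1 hg.1, add_mul]
  smul_mem' := by
    rintro c f ⟨hf, hf0⟩
    refine ⟨memHardy_of_memℓp (hf.1.const_smul c) ?_, fun z hz => by simp [hf0 z hz]⟩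
    convert (memℓp_coeff hf).const_smul c using 1
    funext k
    simp [coeff_smul c hf.1, mul_assoc]

/-- The weighted Hardy space of functions on the open unit disk with weight sequence `w`. -/
def HardySpace (w : Weight) : Type := hardySubmodule w

instance (w : Weight) : AddCommGroup (HardySpace w) :=
  inferInstanceAs (AddCommGroup (hardySubmodule w))

instance (w : Weight) : Module ℂ (HardySpace w) :=
  inferInstanceAs (Module ℂ (hardySubmodule w))

instance (w : Weight) : CoeFun (HardySpace w) (fun _ => ℂ → ℂ) := ⟨fun f => f.1⟩

variable {w : Weight}

theorem HardySpace.mem (f : HardySpace w) : MemHardy w f := f.2.1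

theorem HardySpace.zero_off (f : HardySpace w) {z : ℂ} (hz : z ∉ disk) : f z = 0 := f.2.2 z hz

theorem HardySpace.add_apply (f g : HardySpace w) (z : ℂ) : (f + g) z = f z + g z := rfl

theorem HardySpace.smul_apply (c : ℂ) (f : HardySpace w) (z : ℂ) : (c • f) z = c * f z := rfl

theorem HardySpace.ext {f g : HardySpace w} (h : ∀ z ∈ disk, f z = g z) : f = g := by
  refine Subtype.ext (funext fun z => ?_)
  by_cases hz : z ∈ disk
  · exact h z hz
  · exact (f.zero_off hz).trans (g.zero_off hz).symm

/-- The coefficient map `f ↦ (f̂(k) w(k))ₖ` into `ℓ²`. -/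
def toL2 (w : Weight) : HardySpace w →ₗ[ℂ] lp (fun _ : ℕ => ℂ) 2 where
  toFun f := ⟨fun k => coeff f k * (w k : ℂ), memℓp_coeff f.mem⟩
  map_add' f g := by
    ext k
    have := coeff_add f.mem.1 g.mem.1 k
    change coeff ((f : ℂ → ℂ) + (g : ℂ → ℂ)) k * (w k : ℂ) = coeff f k * w k + coeff g k * w k
    rw [this, add_mul]
  map_smul' c f := by
    ext k
    have := coeff_smul c f.mem.1 k
    change coeff (c • (f : ℂ → ℂ)) k * (w k : ℂ) = c * (coeff f k * w k)
    rw [this, mul_assoc]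

theorem toL2_apply (f : HardySpace w) (k : ℕ) : toL2 w f k = coeff f k * (w k : ℂ) := rfl

theorem toL2_injective (w : Weight) : Function.Injective (toL2 w) := by
  intro f g h
  have hc : ∀ k, coeff f k = coeff g k := by
    intro k
    have := congrArg (fun x : lp (fun _ : ℕ => ℂ) 2 => x k) h
    simp only [toL2_apply] at this
    exact mul_right_cancel₀ (by exact_mod_cast (w.pos' k).ne') this
  refine HardySpace.ext fun z hz => ?_
  have h1 := hasSum_coeff f.mem.1 hz
  simp only [hc] at h1
  exact h1.unique (hasSum_coeff g.mem.1 hz)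

theorem toL2_surjective (w : Weight) : Function.Surjective (toL2 w) := by
  intro x
  have hw : ∀ k, (w k : ℂ) ≠ 0 := fun k => by exact_mod_cast (w.pos' k).ne'
  obtain ⟨f, hf, hf0, hc⟩ := memHardy_of_coeffs w (a := fun k => x k / (w k : ℂ)) (by
    refine ((lp.memℓp x).summable (by norm_num)).congr fun k => ?_
    have := (w.pos' k).ne'
    simp only [norm_div, Complex.norm_real, Real.norm_eq_abs, div_pow, sq_abs]
    simp
    field_simp)
  refine ⟨⟨f, hf, hf0⟩, ?_⟩
  ext k
  change coeff f k * (w k : ℂ) = x k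
  rw [hc, div_mul_cancel₀ _ (hw k)]

/-- The sum `∑ conj(f̂(k)) ĝ(k) w(k)²`. As everywhere in Mathlib, the inner product is linear
in the second variable. -/
def innerSum (f g : HardySpace w) : ℂ :=
  ∑' k, (starRingEnd ℂ) (coeff f k) * coeff g k * (w k : ℂ) ^ 2

theorem innerSum_eq (f g : HardySpace w) : innerSum f g = inner ℂ (toL2 w f) (toL2 w g) := by
  rw [lp.inner_eq_tsum]
  refine tsum_congr fun k => ?_
  simp only [toL2_apply, RCLike.inner_apply, map_mul, Complex.conj_ofReal]
  ring

/-- The inner product of the weighted Hardy space. -/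
abbrev innerCore (w : Weight) : InnerProductSpace.Core ℂ (HardySpace w) where
  inner := innerSum
  conj_inner_symm f g := by
    change (starRingEnd ℂ) (innerSum g f) = innerSum f g
    rw [innerSum_eq, innerSum_eq, inner_conj_symm]
  re_inner_nonneg f := by
    rw [innerSum_eq]
    exact inner_self_nonneg
  add_left f g k := by
    change innerSum (f + g) k = innerSum f k + innerSum g k
    simp only [innerSum_eq, map_add, inner_add_left]
  smul_left f g c := by
    change innerSum (c • f) g = (starRingEnd ℂ) c * innerSum f g
    simp only [innerSum_eq, map_smul, inner_smul_left]
  definite f hf := by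
    change innerSum f f = 0 at hf
    rw [innerSum_eq, inner_self_eq_zero] at hf
    exact toL2_injective w (hf.trans (map_zero _).symm)

instance (w : Weight) : NormedAddCommGroup (HardySpace w) :=
  (innerCore w).toNormedAddCommGroup

instance (w : Weight) : InnerProductSpace ℂ (HardySpace w) :=
  InnerProductSpace.ofCore (innerCore w).toCore

theorem inner_eq_tsum (f g : HardySpace w) :
    inner ℂ f g = ∑' k, (starRingEnd ℂ) (coeff f k) * coeff g k * (w k : ℂ) ^ 2 := rfl

/-- The coefficient map as a unitary operator onto `ℓ²`. -/
def toL2Equiv (w : Weight) : HardySpace w ≃ₗᵢ[ℂ] lp (fun _ : ℕ => ℂ) 2 :=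
  LinearIsometryEquiv.ofSurjective
    (LinearMap.isometryOfInner (toL2 w) fun f g => (innerSum_eq f g).symm) (toL2_surjective w)

instance (w : Weight) : CompleteSpace (HardySpace w) :=
  (toL2Equiv w).toIsometryEquiv.completeSpace

theorem norm_coeff_le (f : HardySpace w) (k : ℕ) : ‖coeff f k‖ ≤ ‖f‖ / w k := by
  rw [le_div_iff₀ (w.pos' k)]
  have h := lp.norm_apply_le_norm (p := 2) (by norm_num) (toL2Equiv w f) k
  rw [LinearIsometryEquiv.norm_map] at h
  change ‖coeff f k * (w k : ℂ)‖ ≤ ‖f‖ at h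
  rwa [norm_mul, Complex.norm_real, Real.norm_of_nonneg (w.pos' k).le] at h

theorem norm_apply_le (f : HardySpace w) {z : ℂ} (hz : z ∈ disk) :
    ‖f z‖ ≤ ‖f‖ * ∑' k, ‖z‖ ^ k / w k := by
  have hz1 : ‖z‖ < 1 := by simpa using hz
  have hs := (summable_pow_div w (norm_nonneg z) hz1).mul_left ‖f‖
  rw [← (hasSum_coeff f.mem.1 hz).tsum_eq, ← tsum_mul_left]
  refine tsum_of_norm_bounded hs.hasSum fun k => ?_
  rw [norm_mul, norm_pow]
  calc ‖coeff f k‖ * ‖z‖ ^ k ≤ ‖f‖ / w k * ‖z‖ ^ k := by gcongr; exact norm_coeff_le f k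
    _ = ‖f‖ * (‖z‖ ^ k / w k) := by ring

theorem tendsto_apply {u : ℕ → HardySpace w} {f : HardySpace w} (h : Tendsto u atTop (𝓝 f))
    {z : ℂ} (hz : z ∈ disk) : Tendsto (fun n => u n z) atTop (𝓝 (f z)) := by
  let e : HardySpace w →ₗ[ℂ] ℂ :=
    { toFun := fun f => f z, map_add' := fun _ _ => rfl, map_smul' := fun _ _ => rfl }
  let E := e.mkContinuous (∑' k, ‖z‖ ^ k / w k) fun f => by
    rw [mul_comm]; exact norm_apply_le f hz
  exact (E.continuous.tendsto f).comp h

/-! ### Multipliers -/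

/-- The multipliers from the Hardy space of `α` to the Hardy space of `β`: holomorphic functions
`h` on the open unit disk with `h f` in the second space for each `f` in the first. -/
def Mult (α β : Weight) : Set (ℂ → ℂ) :=
  {h | DifferentiableOn ℂ h disk ∧ ∀ f, MemHardy α f → MemHardy β (h * f)}

/-- Multiplication `f ↦ h f` as a linear map. -/
def mulLin (α β : Weight) (h : ℂ → ℂ) (hh : h ∈ Mult α β) :
    HardySpace α →ₗ[ℂ] HardySpace β where
  toFun f := ⟨h * f.1, hh.2 f.1 f.mem, fun z hz => by simp [f.zero_off hz]⟩
  map_add' f g := Subtype.ext (mul_add h f.1 g.1)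
  map_smul' c f := Subtype.ext (mul_smul_comm c h f.1)

theorem mulLin_apply {α β : Weight} {h : ℂ → ℂ} (hh : h ∈ Mult α β) (f : HardySpace α) (z : ℂ) :
    mulLin α β h hh f z = h z * f z := rfl

/-- The multiplication operator `f ↦ h f`, bounded by the closed graph theorem. -/
def mulOp (α β : Weight) (h : ℂ → ℂ) (hh : h ∈ Mult α β) : HardySpace α →L[ℂ] HardySpace β :=
  ContinuousLinearMap.ofSeqClosedGraph (g := mulLin α β h hh) fun u f g hu hg => by
    refine HardySpace.ext fun z hz => ?_
    exact tendsto_nhds_unique (tendsto_apply hg hz) ((tendsto_apply hu hz).const_mul (h z))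

theorem mulOp_apply {α β : Weight} {h : ℂ → ℂ} (hh : h ∈ Mult α β) (f : HardySpace α) (z : ℂ) :
    mulOp α β h hh f z = h z * f z := rfl

/-- The coordinate function is a multiplier of each weighted Hardy space. -/
theorem id_mem_mult (w : Weight) : (fun z => z) ∈ Mult w w := by
  refine ⟨differentiableOn_id, fun f hf => ?_⟩
  have hd : DifferentiableOn ℂ ((fun z => z) * f) disk := differentiableOn_id.mul hf.1
  have hc : coeff ((fun z => z) * f) = fun k => Nat.casesOn k 0 (coeff f) := by
    refine coeff_unique hd fun z hz => ?_
    rw [← hasSum_nat_add_iff' 1]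
    simp only [Finset.range_one, Finset.sum_singleton, Pi.mul_apply]
    simpa [pow_succ, mul_assoc, mul_comm, mul_left_comm] using (hasSum_coeff hf.1 hz).mul_left z
  refine ⟨hd, ?_⟩
  rw [hc, ← summable_nat_add_iff 1]
  obtain ⟨C, hC⟩ := w.ratio'.bddAbove_range
  have hCk : ∀ k, w (k + 1) ≤ C * w k := fun k => by
    rw [← div_le_iff₀ (w.pos' k)]
    exact hC ⟨k, rfl⟩
  refine Summable.of_nonneg_of_le (fun k => by positivity) (fun k => ?_) (hf.2.mul_left (C ^ 2))
  have h2 : w (k + 1) ^ 2 ≤ (C * w k) ^ 2 :=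
    pow_le_pow_left₀ (w.pos' _).le (hCk k) 2
  calc ‖coeff f k‖ ^ 2 * w (k + 1) ^ 2 ≤ ‖coeff f k‖ ^ 2 * (C * w k) ^ 2 := by gcongr
    _ = C ^ 2 * (‖coeff f k‖ ^ 2 * w k ^ 2) := by ring

/-- The operator `M_z` of multiplication by the coordinate function. -/
def shift (w : Weight) : HardySpace w →L[ℂ] HardySpace w := mulOp w w (fun z => z) (id_mem_mult w)

/-- The operator `[[M_z^*, M_h^*], [0, M_z^*]]` on the Hilbert space direct sum of the Hardy
spaces of `α` and `β`, that is, `(f, g) ↦ (M_z^* f + M_h^* g, M_z^* g)`. -/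
def blockOp (α β : Weight) (h : ℂ → ℂ) (hh : h ∈ Mult α β) :
    WithLp 2 (HardySpace α × HardySpace β) →L[ℂ] WithLp 2 (HardySpace α × HardySpace β) :=
  let e := WithLp.prodContinuousLinearEquiv 2 ℂ (HardySpace α) (HardySpace β)
  let fst := ContinuousLinearMap.fst ℂ (HardySpace α) (HardySpace β)
  let snd := ContinuousLinearMap.snd ℂ (HardySpace α) (HardySpace β)
  e.symm.toContinuousLinearMap ∘L
    (((shift α).adjoint ∘L fst + (mulOp α β h hh).adjoint ∘L snd).prod
      ((shift β).adjoint ∘L snd)) ∘L e.toContinuousLinearMap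

theorem blockOp_apply {α β : Weight} {h : ℂ → ℂ} (hh : h ∈ Mult α β) (f : HardySpace α)
    (g : HardySpace β) :
    blockOp α β h hh (WithLp.toLp 2 (f, g)) =
      WithLp.toLp 2 ((shift α).adjoint f + (mulOp α β h hh).adjoint g, (shift β).adjoint g) :=
  rfl

/-! ### Möbius invariance and weak homogeneity -/

/-- `φ` restricts to an analytic automorphism of the open unit disk. -/
def IsDiskAut (φ : ℂ → ℂ) : Prop := DifferentiableOn ℂ φ disk ∧ BijOn φ disk disk

/-- The weighted Hardy space is closed under composition with automorphisms of the disk. -/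
def MobiusInvariant (w : Weight) : Prop :=
  ∀ φ, IsDiskAut φ → ∀ f, MemHardy w f → MemHardy w (f ∘ φ)

section Operators

variable {E : Type*} [NormedAddCommGroup E] [InnerProductSpace ℂ E]

/-- Similarity of bounded operators. -/
def Similar (S T : E →L[ℂ] E) : Prop :=
  ∃ X : E ≃L[ℂ] E, S ∘L X.toContinuousLinearMap = X.toContinuousLinearMap ∘L T

/-- `S = φ(T)` in the analytic functional calculus, for `φ` analytic on a disk of radius greater
than `1` about the origin and `T` with spectrum in the closed unit disk. In that situation
`φ(T) = ∑ φ̂(k) Tᵏ` with convergence in operator norm. Each automorphism of the unit disk extends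
analytically to such a larger disk, and its coefficients at the origin are those of the
extension. -/
def IsCalculus (φ : ℂ → ℂ) (T S : E →L[ℂ] E) : Prop :=
  HasSum (fun k => coeff φ k • T ^ k) S

/-- `T` is weakly homogeneous: its spectrum lies in the closed unit disk and `φ(T)` is similar
to `T` for each automorphism `φ` of the open unit disk. -/
def WeaklyHomogeneous (T : E →L[ℂ] E) : Prop :=
  spectrum ℂ T ⊆ closedDisk ∧
    ∀ φ, IsDiskAut φ → ∃ S : E →L[ℂ] E, IsCalculus φ T S ∧ Similar S T

end Operators

end

end WeightedHardy

/-!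
The adjoint `A` of `blockOp α β h` is `(f, g) ↦ (z f, h f + z g)`, so that
`φ(A) (f, g) = (φ f, φ' h f + φ g)`. Weak homogeneity passes to the adjoint and yields, for each
automorphism `φ` of the disk, an invertible operator matrix `V` with `V A = φ(A) V`. The entry
`V₁₂` satisfies `L M_z = M_φ L` and is therefore a weighted composition operator. This makes the
identity for `V₁₁` one of the form `L M_z = M_φ L + θ · C_φ`, where `C_φ f = f ∘ φ`. Such an
identity gives `φ · L zⁿ = φⁿ (φ · L 1 + n θ)`, and since `‖L zⁿ‖` grows more slowly than `n`
times the weight of the target space, `θ = 0`.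

If `h ≠ 0`, this forces `V₁₂ = 0`. Then `V₁₁ f = r · (f ∘ φ)` and `V₂₂ g = q · (g ∘ φ)`, and the
same growth argument for `V₂₁`, now with `α(n) = o(n β(n))`, gives `φ' h r = q · (h ∘ φ)`. As
`1 / r` and `q` are multipliers, they are bounded, whence `|φ'| |h| ≤ C |h ∘ φ|`. The zero set of
`h` in the disk is thus invariant under a transitive group, and a zero on the unit circle spreads
over the circle by rotations, so that `h = 0` by the maximum principle.
-/

namespace WeightedHardy

noncomputable section

/-! ### Injective holomorphic functions -/

section Injective

variable {U : Set ℂ} {f : ℂ → ℂ} {z : ℂ}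

theorem not_eventually_eq_of_injOn (hU : IsOpen U) (hf : InjOn f U) (hz : z ∈ U) :
    ¬∀ᶠ w in 𝓝 z, f w = f z := by
  intro h
  have hne : ∀ᶠ w in 𝓝[≠] z, w ≠ z := eventually_mem_nhdsWithin
  obtain ⟨w, hwz, hw, hwU⟩ :=
    (hne.and (((hU.eventually_mem hz).and h).filter_mono nhdsWithin_le_nhds)).exists
  exact hwz (hf hw hz hwU)

theorem nhds_le_map_nhds_of_injOn (hU : IsOpen U) (hd : DifferentiableOn ℂ f U)
    (hf : InjOn f U) (hz : z ∈ U) : 𝓝 (f z) ≤ map f (𝓝 z) :=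
  (hd.analyticAt (hU.mem_nhds hz)).eventually_constant_or_nhds_le_map_nhds.resolve_left
    (not_eventually_eq_of_injOn hU hf hz)

theorem eventually_deriv_ne_zero_of_injOn (hU : IsOpen U) (hd : DifferentiableOn ℂ f U)
    (hf : InjOn f U) (hz : z ∈ U) : ∀ᶠ w in 𝓝[≠] z, deriv f w ≠ 0 := by
  have hd' : AnalyticAt ℂ (deriv f) z := (hd.analyticAt (hU.mem_nhds hz)).deriv
  refine hd'.eventually_eq_zero_or_eventually_ne_zero.resolve_left fun h0 => ?_
  obtain ⟨ε, hε, hball⟩ := Metric.eventually_nhds_iff_ball.1 (h0.and (hU.eventually_mem hz))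
  refine not_eventually_eq_of_injOn hU hf hz ?_
  filter_upwards [Metric.ball_mem_nhds z hε] with w hw
  exact Metric.isOpen_ball.is_const_of_deriv_eq_zero (convex_ball z ε).isPreconnected
    (hd.mono fun v hv => (hball v hv).2) (fun v hv => (hball v hv).1) hw
    (Metric.mem_ball_self hε)

theorem continuousAt_invFunOn (hU : IsOpen U) (hd : DifferentiableOn ℂ f U)
    (hf : InjOn f U) (hz : z ∈ U) : ContinuousAt (Function.invFunOn f U) (f z) := by
  have hinv : (Function.invFunOn f U ∘ f) =ᶠ[𝓝 z] id :=
    hf.leftInvOn_invFunOn.eqOn.eventuallyEq_of_mem (hU.mem_nhds hz)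
  rw [ContinuousAt, hf.leftInvOn_invFunOn hz]
  exact (tendsto_map'_iff.2 (tendsto_id.congr' hinv.symm)).mono_left
    (nhds_le_map_nhds_of_injOn hU hd hf hz)

theorem differentiableAt_invFunOn_of_deriv_ne_zero (hU : IsOpen U)
    (hd : DifferentiableOn ℂ f U) (hf : InjOn f U) (hz : z ∈ U) (h0 : deriv f z ≠ 0) :
    DifferentiableAt ℂ (Function.invFunOn f U) (f z) := by
  have hinv : Function.invFunOn f U (f z) = z := hf.leftInvOn_invFunOn hz
  have hderiv : HasDerivAt f (deriv f z) (Function.invFunOn f U (f z)) := by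
    rw [hinv]
    exact (hd.differentiableAt (hU.mem_nhds hz)).hasDerivAt
  refine (hderiv.of_local_left_inverse (continuousAt_invFunOn hU hd hf hz) h0
    (nhds_le_map_nhds_of_injOn hU hd hf hz ?_)).differentiableAt
  refine eventually_map.2 ?_
  filter_upwards [hU.mem_nhds hz] with w hw
  exact congrArg f (hf.leftInvOn_invFunOn hw)

-- `f'` may vanish only at isolated points, where the continuous inverse has a removable
-- singularity.
theorem differentiableAt_invFunOn (hU : IsOpen U) (hd : DifferentiableOn ℂ f U)
    (hf : InjOn f U) (hz : z ∈ U) : DifferentiableAt ℂ (Function.invFunOn f U) (f z) := by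
  refine (Complex.analyticAt_of_differentiable_on_punctured_nhds_of_continuousAt ?_
    (continuousAt_invFunOn hU hd hf hz)).differentiableAt
  refine eventually_nhdsWithin_iff.2 (nhds_le_map_nhds_of_injOn hU hd hf hz ?_)
  refine eventually_map.2 ?_
  filter_upwards [hU.mem_nhds hz,
    eventually_nhdsWithin_iff.1 (eventually_deriv_ne_zero_of_injOn hU hd hf hz)] with w hw hw0 hwz
  exact differentiableAt_invFunOn_of_deriv_ne_zero hU hd hf hw (hw0 (ne_of_apply_ne f hwz))

theorem deriv_ne_zero_of_injOn (hU : IsOpen U) (hd : DifferentiableOn ℂ f U)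
    (hf : InjOn f U) (hz : z ∈ U) : deriv f z ≠ 0 := by
  intro h0
  have hcomp := (differentiableAt_invFunOn hU hd hf hz).hasDerivAt.comp z
    (hd.differentiableAt (hU.mem_nhds hz)).hasDerivAt
  have hinv : (Function.invFunOn f U ∘ f) =ᶠ[𝓝 z] id :=
    hf.leftInvOn_invFunOn.eqOn.eventuallyEq_of_mem (hU.mem_nhds hz)
  rw [h0, mul_zero] at hcomp
  exact zero_ne_one ((hcomp.congr_of_eventuallyEq hinv.symm).unique (hasDerivAt_id z))

end Injective

/-! ### Automorphisms of the disk -/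

theorem isOpen_disk : IsOpen disk := Metric.isOpen_ball

theorem closure_disk : closure disk = closedDisk := closure_ball 0 one_ne_zero

theorem star_mem_disk {z : ℂ} : star z ∈ disk ↔ z ∈ disk := by simp

section Automorphisms

variable {φ ψ : ℂ → ℂ} {a c z w : ℂ}

theorem IsDiskAut.deriv_ne_zero (hφ : IsDiskAut φ) (hz : z ∈ disk) : deriv φ z ≠ 0 :=
  deriv_ne_zero_of_injOn isOpen_disk hφ.1 hφ.2.injOn hz

theorem IsDiskAut.invOn_invFunOn (hφ : IsDiskAut φ) :
    InvOn (Function.invFunOn φ disk) φ disk disk :=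
  hφ.2.invOn_invFunOn

theorem IsDiskAut.invFunOn (hφ : IsDiskAut φ) : IsDiskAut (Function.invFunOn φ disk) := by
  refine ⟨fun w hw => ?_, (bijOn_comm hφ.invOn_invFunOn).2 hφ.2⟩
  obtain ⟨z, hz, rfl⟩ := hφ.2.surjOn hw
  exact (differentiableAt_invFunOn isOpen_disk hφ.1 hφ.2.injOn hz).differentiableWithinAt

theorem IsDiskAut.comp (hφ : IsDiskAut φ) (hψ : IsDiskAut ψ) : IsDiskAut (φ ∘ ψ) :=
  ⟨hφ.1.comp hψ.1 hψ.2.mapsTo, hφ.2.comp hψ.2⟩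

theorem differentiableOn_star_conj (hφ : DifferentiableOn ℂ φ disk) :
    DifferentiableOn ℂ (fun z => star (φ (star z))) disk := fun z hz => by
  have hd := (hφ.differentiableAt (isOpen_disk.mem_nhds (star_mem_disk.2 hz))).star_star
  rw [star_star] at hd
  exact hd.differentiableWithinAt

theorem IsDiskAut.star_conj (hφ : IsDiskAut φ) : IsDiskAut fun z => star (φ (star z)) := by
  have hstar : BijOn star disk disk :=
    ⟨fun _ => star_mem_disk.2, star_injective.injOn,
      fun z hz => ⟨star z, star_mem_disk.2 hz, star_star z⟩⟩
  exact ⟨differentiableOn_star_conj hφ.1, hstar.comp (hφ.2.comp hstar)⟩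

theorem isDiskAut_of_invOn (hφ : DifferentiableOn ℂ φ disk) (hm : MapsTo φ disk disk)
    (hm' : MapsTo ψ disk disk) (hinv : InvOn ψ φ disk disk) : IsDiskAut φ :=
  ⟨hφ, hinv.bijOn hm hm'⟩

theorem isDiskAut_const_mul (hc : ‖c‖ = 1) : IsDiskAut (c * ·) := by
  have hc0 : c ≠ 0 := norm_ne_zero_iff.1 (hc.trans_ne one_ne_zero)
  exact isDiskAut_of_invOn (ψ := (c⁻¹ * ·)) (by fun_prop) (fun z hz => by simpa [hc] using hz)
    (fun z hz => by simpa [hc] using hz)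
    ⟨fun z _ => inv_mul_cancel_left₀ hc0 z, fun z _ => mul_inv_cancel_left₀ hc0 z⟩

/-- The Blaschke factor `z ↦ (a - z) / (1 - āz)`, for `a` in the disk the involutive automorphism
of the disk that exchanges `0` and `a`. -/
def involution (a z : ℂ) : ℂ := (a - z) / (1 - star a * z)

theorem involution_zero (a : ℂ) : involution a 0 = a := by simp [involution]

theorem one_sub_star_mul_ne_zero (ha : a ∈ disk) (hz : z ∈ disk) : 1 - star a * z ≠ 0 := by
  rw [mem_ball_zero_iff] at ha hz
  intro h
  have hnorm : ‖a‖ * ‖z‖ = 1 := by rw [← norm_star a, ← norm_mul, ← sub_eq_zero.1 h, norm_one]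
  nlinarith [norm_nonneg a, norm_nonneg z]

theorem norm_one_sub_star_mul_sq_sub (a z : ℂ) :
    ‖1 - star a * z‖ ^ 2 - ‖a - z‖ ^ 2 = (1 - ‖a‖ ^ 2) * (1 - ‖z‖ ^ 2) := by
  simp only [← Complex.normSq_eq_norm_sq, Complex.normSq_apply, Complex.sub_re, Complex.sub_im,
    Complex.mul_re, Complex.mul_im, Complex.one_re, Complex.one_im, Complex.star_def,
    Complex.conj_re, Complex.conj_im]
  ring

theorem involution_mem_disk (ha : a ∈ disk) (hz : z ∈ disk) : involution a z ∈ disk := by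
  have hpos : 0 < ‖1 - star a * z‖ := norm_pos_iff.2 (one_sub_star_mul_ne_zero ha hz)
  rw [mem_ball_zero_iff] at ha hz ⊢
  rw [involution, norm_div, div_lt_one hpos]
  refine lt_of_pow_lt_pow_left₀ 2 hpos.le (sub_pos.1 ?_)
  rw [norm_one_sub_star_mul_sq_sub]
  exact mul_pos (sub_pos.2 (pow_lt_one₀ (norm_nonneg a) ha two_ne_zero))
    (sub_pos.2 (pow_lt_one₀ (norm_nonneg z) hz two_ne_zero))

theorem involution_involution (ha : a ∈ disk) (hz : z ∈ disk) :
    involution a (involution a z) = z := by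
  have hden := one_sub_star_mul_ne_zero ha hz
  have hinv : involution a z * (1 - star a * z) = a - z := div_mul_cancel₀ _ hden
  rw [involution, div_eq_iff (one_sub_star_mul_ne_zero ha (involution_mem_disk ha hz))]
  refine mul_right_cancel₀ hden ?_
  linear_combination (-1 + z * star a) * hinv

theorem isDiskAut_involution (ha : a ∈ disk) : IsDiskAut (involution a) := by
  have hm : MapsTo (involution a) disk disk := fun z hz => involution_mem_disk ha hz
  have hinv : LeftInvOn (involution a) (involution a) disk := fun z hz =>
    involution_involution ha hz
  refine isDiskAut_of_invOn ?_ hm hm ⟨hinv, hinv⟩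
  exact DifferentiableOn.div (by fun_prop) (by fun_prop) fun z hz => one_sub_star_mul_ne_zero ha hz

theorem exists_isDiskAut_apply_eq (hw : w ∈ disk) (hz : z ∈ disk) :
    ∃ φ, IsDiskAut φ ∧ φ w = z := by
  refine ⟨involution z ∘ involution w, (isDiskAut_involution hz).comp (isDiskAut_involution hw), ?_⟩
  have hw0 : involution w w = 0 := by simp [involution]
  rw [Function.comp_apply, hw0, involution_zero]

end Automorphisms

/-! ### Power series coefficients -/

theorem coeff_congr {f g : ℂ → ℂ} (hg : DifferentiableOn ℂ g disk) (h : EqOn f g disk) :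
    coeff f = coeff g :=
  coeff_unique (hg.congr h) fun z hz => by rw [h hz]; exact hasSum_coeff hg hz

theorem coeff_pow_mul {f : ℂ → ℂ} (hf : DifferentiableOn ℂ f disk) (n k : ℕ) :
    coeff (fun z => z ^ n * f z) (n + k) = coeff f k := by
  have hc : coeff (fun z => z ^ n * f z) = fun j => if n ≤ j then coeff f (j - n) else 0 := by
    refine coeff_unique ((differentiableOn_id.pow n).mul hf) fun z hz => ?_
    rw [← hasSum_nat_add_iff' n,
      Finset.sum_eq_zero fun j hj => by simp [not_le.2 (Finset.mem_range.1 hj)], sub_zero]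
    simpa [pow_add, mul_assoc, mul_comm, mul_left_comm] using (hasSum_coeff hf hz).mul_left (z ^ n)
  simp [hc]

theorem coeff_pow (n : ℕ) : coeff (fun z => z ^ n) = Pi.single n 1 := by
  refine coeff_unique (differentiableOn_id.pow n) fun z _ => ?_
  convert hasSum_single (f := fun k => (Pi.single n (1 : ℂ) : ℕ → ℂ) k * z ^ k) n ?_ using 1
  · simp
  · intro k hk
    simp [hk]

theorem coeff_deriv (f : ℂ → ℂ) (k : ℕ) : coeff (deriv f) k = (k + 1) * coeff f (k + 1) := by
  have := k.factorial_ne_zero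
  simp only [coeff, iteratedDeriv_succ', Nat.factorial_succ]
  push_cast
  field_simp

theorem coeff_star_conj {φ : ℂ → ℂ} (hφ : DifferentiableOn ℂ φ disk) (k : ℕ) :
    coeff (fun z => star (φ (star z))) k = star (coeff φ k) := by
  refine congrFun (coeff_unique (a := fun k => star (coeff φ k))
    (differentiableOn_star_conj hφ) fun z hz => ?_) k
  refine (hasSum_coeff hφ (star_mem_disk.2 hz)).star.congr_fun fun k => ?_
  simp

theorem eqOn_zero_of_coeff_eq_zero {f : ℂ → ℂ} (hf : DifferentiableOn ℂ f disk)
    (h : ∀ k, coeff f k = 0) : EqOn f 0 disk := fun _ hz =>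
  (hasSum_coeff hf hz).unique (by simp [h])

theorem hasSum_deriv {f : ℂ → ℂ} (hf : DifferentiableOn ℂ f disk) {z : ℂ} (hz : z ∈ disk) :
    HasSum (fun k : ℕ => coeff f k * (k * z ^ (k - 1))) (deriv f z) := by
  rw [← hasSum_nat_add_iff' 1]
  have h := hasSum_coeff (hf.deriv isOpen_disk) hz
  simp only [coeff_deriv] at h
  simpa [mul_assoc, mul_comm, mul_left_comm] using h

/-! ### Functions, monomials and point evaluations in the Hardy space -/

theorem MemHardy.congr {w : Weight} {f g : ℂ → ℂ} (hf : MemHardy w f) (h : EqOn g f disk) :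
    MemHardy w g :=
  ⟨hf.1.congr h, by rw [coeff_congr hf.1 h]; exact hf.2⟩

/-- The element of the Hardy space given by a function on the disk: its values off the disk are
replaced by `0`. -/
def HardySpace.ofMem {w : Weight} {f : ℂ → ℂ} (hf : MemHardy w f) : HardySpace w :=
  ⟨disk.indicator f, hf.congr fun _ hz => indicator_of_mem hz f,
    fun _ hz => indicator_of_notMem hz f⟩

theorem HardySpace.ofMem_apply {w : Weight} {f : ℂ → ℂ} (hf : MemHardy w f) {z : ℂ}
    (hz : z ∈ disk) : HardySpace.ofMem hf z = f z := indicator_of_mem hz f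

theorem shift_apply (w : Weight) (f : HardySpace w) (z : ℂ) : shift w f z = z * f z := rfl

theorem memHardy_pow (w : Weight) (n : ℕ) : MemHardy w fun z => z ^ n := by
  refine ⟨differentiableOn_id.pow n, ?_⟩
  rw [coeff_pow]
  exact summable_of_ne_finset_zero (s := {n}) fun k hk => by
    simp [Finset.notMem_singleton.1 hk]

/-- The monomial `zⁿ` as an element of the Hardy space; a bounded operator is determined by its
values on these. -/
def monomial (w : Weight) (n : ℕ) : HardySpace w := HardySpace.ofMem (memHardy_pow w n)

theorem monomial_apply (w : Weight) (n : ℕ) {z : ℂ} (hz : z ∈ disk) : monomial w n z = z ^ n :=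
  HardySpace.ofMem_apply _ hz

theorem monomial_zero_apply (w : Weight) {z : ℂ} (hz : z ∈ disk) : monomial w 0 z = 1 := by
  rw [monomial_apply w 0 hz, pow_zero]

theorem shift_monomial (w : Weight) (n : ℕ) : shift w (monomial w n) = monomial w (n + 1) :=
  HardySpace.ext fun z hz => by
    rw [shift_apply, monomial_apply w _ hz, monomial_apply w _ hz, pow_succ']

theorem coeff_monomial (w : Weight) (n : ℕ) : coeff (monomial w n) = Pi.single n 1 := by
  rw [← coeff_pow]
  exact coeff_congr (differentiableOn_id.pow n) fun z hz => monomial_apply w n hz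

theorem toL2Equiv_monomial (w : Weight) (n : ℕ) :
    toL2Equiv w (monomial w n) = lp.single 2 n (w n : ℂ) := by
  ext k
  change coeff (monomial w n) k * (w k : ℂ) = _
  rw [coeff_monomial, lp.single_apply]
  rcases eq_or_ne k n with rfl | hk
  · simp
  · simp [hk]

theorem norm_monomial (w : Weight) (n : ℕ) : ‖monomial w n‖ = w n := by
  rw [← (toL2Equiv w).norm_map, toL2Equiv_monomial, lp.norm_single (by norm_num),
    Complex.norm_real, Real.norm_of_nonneg (w.pos' n).le]

theorem hasSum_monomial {w : Weight} (f : HardySpace w) :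
    HasSum (fun k => coeff f k • monomial w k) f := by
  rw [← (toL2Equiv w).toContinuousLinearEquiv.hasSum']
  refine (lp.hasSum_single (by norm_num) (toL2Equiv w f)).congr_fun fun k => ?_
  change toL2Equiv w (coeff f k • monomial w k) = _
  rw [map_smul, toL2Equiv_monomial, ← lp.single_smul]
  rfl

/-- Evaluation at a point of the disk, as a bounded functional on the Hardy space. -/
def evalAt (w : Weight) {z : ℂ} (hz : z ∈ disk) : HardySpace w →L[ℂ] ℂ :=
  LinearMap.mkContinuous
    { toFun := fun f => f z, map_add' := fun _ _ => rfl, map_smul' := fun _ _ => rfl }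
    (∑' k, ‖z‖ ^ k / w k) fun f => by
      rw [mul_comm]
      exact norm_apply_le f hz

theorem evalAt_apply {w : Weight} {z : ℂ} (hz : z ∈ disk) (f : HardySpace w) :
    evalAt w hz f = f z := rfl

theorem norm_le_opNorm_of_functional_apply_eq {𝕜 E : Type*} [NontriviallyNormedField 𝕜]
    [NormedAddCommGroup E] [NormedSpace 𝕜 E] {A : E →L[𝕜] E} {e : E →L[𝕜] 𝕜} {c : 𝕜} {x : E}
    (hx : e x ≠ 0) (h : ∀ y, e (A y) = c * e y) : ‖c‖ ≤ ‖A‖ := by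
  have heigen : e ∘L A = c • e := ContinuousLinearMap.ext h
  have he : 0 < ‖e‖ := norm_pos_iff.2 fun he => hx (by rw [he, zero_apply])
  refine le_of_mul_le_mul_right ?_ he
  calc ‖c‖ * ‖e‖ = ‖e ∘L A‖ := by rw [heigen, norm_smul]
    _ ≤ ‖e‖ * ‖A‖ := e.opNorm_comp_le A
    _ = ‖A‖ * ‖e‖ := mul_comm _ _

-- `r z` is an eigenvalue of the adjoint of `M_r`, with eigenfunctional the evaluation at `z`.
theorem norm_apply_le_norm_mulOp {w : Weight} {r : ℂ → ℂ} (hr : r ∈ Mult w w) {z : ℂ}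
    (hz : z ∈ disk) : ‖r z‖ ≤ ‖mulOp w w r hr‖ := by
  have hone : evalAt w hz (monomial w 0) ≠ 0 := by
    rw [evalAt_apply, monomial_zero_apply w hz]
    exact one_ne_zero
  exact norm_le_opNorm_of_functional_apply_eq hone (mulOp_apply hr · z)

/-! ### Composition operators -/

section Composition

variable {w : Weight} {φ : ℂ → ℂ}

/-- Composition `f ↦ f ∘ φ` with an automorphism of the disk as a linear map. -/
def compLin (hw : MobiusInvariant w) (hφ : IsDiskAut φ) : HardySpace w →ₗ[ℂ] HardySpace w where
  toFun f := HardySpace.ofMem (hw φ hφ f f.mem)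
  map_add' f g := HardySpace.ext fun z hz => by
    simp only [HardySpace.add_apply, HardySpace.ofMem_apply _ hz, Function.comp_apply]
  map_smul' c f := HardySpace.ext fun z hz => by
    simp only [RingHom.id_apply, HardySpace.smul_apply, HardySpace.ofMem_apply _ hz,
      Function.comp_apply]

theorem compLin_apply (hw : MobiusInvariant w) (hφ : IsDiskAut φ) (f : HardySpace w) {z : ℂ}
    (hz : z ∈ disk) : compLin hw hφ f z = f (φ z) :=
  HardySpace.ofMem_apply (hw φ hφ f f.mem) hz

/-- The composition operator `f ↦ f ∘ φ`, bounded by the closed graph theorem. -/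
def compOp (hw : MobiusInvariant w) (hφ : IsDiskAut φ) : HardySpace w →L[ℂ] HardySpace w :=
  ContinuousLinearMap.ofSeqClosedGraph (g := compLin hw hφ) fun u f g hu hg => by
    refine HardySpace.ext fun z hz => ?_
    have hlim := tendsto_apply hg hz
    simp only [Function.comp_apply, compLin_apply hw hφ _ hz] at hlim
    rw [compLin_apply hw hφ f hz]
    exact tendsto_nhds_unique hlim (tendsto_apply hu (hφ.2.mapsTo hz))

theorem compOp_apply (hw : MobiusInvariant w) (hφ : IsDiskAut φ) (f : HardySpace w) {z : ℂ}
    (hz : z ∈ disk) : compOp hw hφ f z = f (φ z) :=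
  compLin_apply hw hφ f hz

end Composition

/-! ### Growth of weights -/

theorem Weight.tendsto_div_add (w : Weight) (k : ℕ) :
    Tendsto (fun n => w n / w (n + k)) atTop (𝓝 1) := by
  induction k with
  | zero => simp [div_self (w.pos' _).ne']
  | succ k ih =>
    have hstep := ih.mul ((w.ratio'.comp (tendsto_add_atTop_nat k)).inv₀ one_ne_zero)
    rw [inv_one, mul_one] at hstep
    refine hstep.congr fun n => ?_
    rw [Function.comp_apply, inv_div, div_mul_div_cancel₀ (w.pos' (n + k)).ne', add_assoc]

theorem Weight.tendsto_div_nat_mul_self (w : Weight) :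
    Tendsto (fun k : ℕ => w k / ((k : ℝ) * w k)) atTop (𝓝 0) :=
  tendsto_inv_atTop_nhds_zero_nat.congr fun k => by
    rw [mul_comm, div_mul_cancel_left₀ (w.pos' k).ne']

theorem coeff_pow_mul_add_natCast_mul {a b : ℂ → ℂ} (ha : DifferentiableOn ℂ a disk)
    (hb : DifferentiableOn ℂ b disk) (n k : ℕ) :
    coeff (fun z => z ^ n * (a z + n * b z)) (n + k) = coeff a k + n * coeff b k := by
  rw [← coeff_smul _ hb, ← coeff_add ha (hb.const_smul (n : ℂ)),
    ← coeff_pow_mul (ha.add (hb.const_smul (n : ℂ))) n]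
  rfl

theorem tendsto_inv_mul_coeff_of_norm_le {w : Weight} {s : ℕ → ℝ}
    (hs : Tendsto (fun k : ℕ => s k / ((k : ℝ) * w k)) atTop (𝓝 0)) {F : ℕ → HardySpace w}
    {C : ℝ} (hF : ∀ n, ‖F n‖ ≤ C * s n) (k : ℕ) :
    Tendsto (fun n : ℕ => (n : ℂ)⁻¹ * coeff (F n) (n + k)) atTop (𝓝 0) := by
  have hbound := (hs.mul (w.tendsto_div_add k)).const_mul C
  rw [zero_mul, mul_zero] at hbound
  refine squeeze_zero_norm (fun n => ?_) hbound
  have hn := (w.pos' n).ne'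
  calc ‖(n : ℂ)⁻¹ * coeff (F n) (n + k)‖ = (n : ℝ)⁻¹ * ‖coeff (F n) (n + k)‖ := by
        rw [norm_mul, norm_inv, Complex.norm_natCast]
    _ ≤ (n : ℝ)⁻¹ * (C * s n / w (n + k)) := by
        gcongr
        exact (norm_coeff_le (F n) (n + k)).trans
          (div_le_div_of_nonneg_right (hF n) (w.pos' (n + k)).le)
    _ = C * (s n / ((n : ℝ) * w n) * (w n / w (n + k))) := by
        rw [div_mul_div_comm, mul_comm (n : ℝ), mul_comm (s n), mul_assoc,
          mul_div_mul_left _ _ hn]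
        simp only [div_eq_mul_inv, mul_inv]
        ring

-- The coefficient of `z ^ (n + k)` in `F n` is `coeff a k + n * coeff b k`, which is `o(n)`.
theorem eqOn_zero_of_norm_le {w : Weight} {s : ℕ → ℝ}
    (hs : Tendsto (fun k : ℕ => s k / ((k : ℝ) * w k)) atTop (𝓝 0)) {a b : ℂ → ℂ}
    (ha : DifferentiableOn ℂ a disk) (hb : DifferentiableOn ℂ b disk) {F : ℕ → HardySpace w}
    {C : ℝ} (hF : ∀ n, ‖F n‖ ≤ C * s n)
    (hFz : ∀ n, EqOn (F n) (fun z => z ^ n * (a z + n * b z)) disk) : EqOn b 0 disk := by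
  refine eqOn_zero_of_coeff_eq_zero hb fun k => ?_
  have hcoeff : ∀ n, coeff (F n) (n + k) = coeff a k + n * coeff b k := fun n => by
    rw [← coeff_congr (F n).mem.1 (hFz n).symm, coeff_pow_mul_add_natCast_mul ha hb]
  have hlim : Tendsto (fun n : ℕ => (n : ℂ)⁻¹ * coeff a k + coeff b k) atTop
      (𝓝 (coeff b k)) := by
    simpa using ((tendsto_inv_atTop_nhds_zero_nat (𝕜 := ℂ)).mul_const (coeff a k)).add_const _
  refine tendsto_nhds_unique (hlim.congr' ?_) (tendsto_inv_mul_coeff_of_norm_le hs hF k)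
  filter_upwards [eventually_ne_atTop 0] with n hn
  rw [hcoeff, mul_add, inv_mul_cancel_left₀ (Nat.cast_ne_zero.2 hn)]

/-! ### Intertwining operators -/

-- `‖L zⁿ‖ = O(α(n))`, whereas `φ · L zⁿ = φⁿ (φ · L 1 + n θ)` on the disk.
theorem eqOn_zero_of_apply_shift_eq {α β : Weight} (hβ : MobiusInvariant β)
    (hαβ : Tendsto (fun k : ℕ => α k / ((k : ℝ) * β k)) atTop (𝓝 0))
    {L : HardySpace α →L[ℂ] HardySpace β} {φ θ : ℂ → ℂ} (hφ : IsDiskAut φ)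
    (hθ : DifferentiableOn ℂ θ disk)
    (hL : ∀ f, ∀ z ∈ disk, L (shift α f) z = φ z * L f z + θ z * f (φ z)) : EqOn θ 0 disk := by
  have hχ := hφ.invFunOn
  have hinv := hφ.invOn_invFunOn
  generalize Function.invFunOn φ disk = χ at hχ hinv
  have hpow : ∀ n, ∀ z ∈ disk, φ z * L (monomial α n) z =
      φ z ^ n * (φ z * L (monomial α 0) z + n * θ z) := by
    intro n z hz
    induction n with
    | zero => simp
    | succ n ih =>
      rw [← shift_monomial, hL _ z hz, monomial_apply α n (hφ.2.mapsTo hz)]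
      push_cast
      linear_combination φ z * ih
  let K := shift β ∘L compOp hβ hχ ∘L L
  have hK : ∀ n, ‖K (monomial α n)‖ ≤ ‖K‖ * α n := fun n => norm_monomial α n ▸ K.le_opNorm _
  have hKz : ∀ n, EqOn (K (monomial α n))
      (fun z => z ^ n * (z * L (monomial α 0) (χ z) + n * (θ ∘ χ) z)) disk := by
    intro n z hz
    have hz' := hpow n (χ z) (hχ.2.mapsTo hz)
    rw [hinv.2 hz] at hz'
    change z * compOp hβ hχ (L (monomial α n)) z = _
    rw [compOp_apply hβ hχ _ hz]
    exact hz'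
  have hzero : EqOn (θ ∘ χ) 0 disk := eqOn_zero_of_norm_le hαβ
    (differentiableOn_id.mul ((L (monomial α 0)).mem.1.comp hχ.1 hχ.2.mapsTo))
    (hθ.comp hχ.1 hχ.2.mapsTo) hK hKz
  intro z hz
  have hθz := hzero (hφ.2.mapsTo hz)
  rwa [Function.comp_apply, hinv.1 hz] at hθz

/-- `L` is the weighted composition operator `f ↦ u · (f ∘ φ)`. -/
def IsWeightedComp {α β : Weight} (L : HardySpace α →L[ℂ] HardySpace β) (u φ : ℂ → ℂ) : Prop :=
  ∀ f, ∀ z ∈ disk, L f z = u z * f (φ z)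

section WeightedComposition

variable {α β : Weight} {L : HardySpace α →L[ℂ] HardySpace β} {u φ : ℂ → ℂ} {z : ℂ}

theorem isWeightedComp_of_apply_shift_eq (hφ : MapsTo φ disk disk)
    (hL : ∀ f, ∀ z ∈ disk, L (shift α f) z = φ z * L f z) :
    IsWeightedComp L (L (monomial α 0)) φ := by
  intro f z hz
  have hpow : ∀ n, L (monomial α n) z = L (monomial α 0) z * φ z ^ n := by
    intro n
    induction n with
    | zero => simp
    | succ n ih => rw [← shift_monomial, hL _ z hz, ih]; ring
  refine ((hasSum_monomial f).mapL (evalAt β hz ∘L L)).unique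
    (((hasSum_coeff f.mem.1 (hφ hz)).mul_left (L (monomial α 0) z)).congr_fun fun k => ?_)
  rw [map_smul, ContinuousLinearMap.comp_apply, evalAt_apply, hpow, smul_eq_mul, mul_left_comm]

theorem IsWeightedComp.apply_monomial_zero (h : IsWeightedComp L u φ)
    (hφ : MapsTo φ disk disk) (hz : z ∈ disk) : L (monomial α 0) z = u z := by
  rw [h _ z hz, monomial_zero_apply α (hφ hz), mul_one]

theorem IsWeightedComp.mem_mult (h : IsWeightedComp L u φ) (hα : MobiusInvariant α)
    (hφ : IsDiskAut φ) : u ∈ Mult α β := by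
  refine ⟨(L (monomial α 0)).mem.1.congr fun z hz =>
    (h.apply_monomial_zero hφ.2.mapsTo hz).symm, fun f hf => ?_⟩
  refine (L (HardySpace.ofMem (hα _ hφ.invFunOn f hf))).mem.congr fun z hz => ?_
  rw [h _ z hz, HardySpace.ofMem_apply _ (hφ.2.mapsTo hz), Function.comp_apply,
    hφ.invOn_invFunOn.1 hz, Pi.mul_apply]

theorem IsWeightedComp.ne_zero (h : IsWeightedComp L u φ) (hL : Function.Surjective L)
    (hz : z ∈ disk) : u z ≠ 0 := by
  obtain ⟨g, hg⟩ := hL (monomial β 0)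
  have hone : u z * g (φ z) = 1 := by rw [← h g z hz, hg, monomial_zero_apply β hz]
  exact left_ne_zero_of_mul_eq_one hone

theorem IsWeightedComp.inv_mem_mult (h : IsWeightedComp L u φ) (hα : MobiusInvariant α)
    (hφ : IsDiskAut φ) (hL : Function.Surjective L) : u⁻¹ ∈ Mult β α := by
  refine ⟨(h.mem_mult hα hφ).1.inv fun z hz => h.ne_zero hL hz, fun f hf => ?_⟩
  obtain ⟨g, hg⟩ := hL (HardySpace.ofMem hf)
  refine (hα φ hφ g g.mem).congr fun z hz => ?_
  rw [Pi.mul_apply, Pi.inv_apply, ← HardySpace.ofMem_apply hf hz, ← hg, h g z hz,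
    inv_mul_cancel_left₀ (h.ne_zero hL hz), Function.comp_apply]

end WeightedComposition

/-! ### Weak homogeneity of the adjoint -/

section Adjoint

variable {E : Type*} [NormedAddCommGroup E] [InnerProductSpace ℂ E] [CompleteSpace E]
  {S T : E →L[ℂ] E} {φ : ℂ → ℂ}

theorem Similar.adjoint (h : Similar S T) : Similar S.adjoint T.adjoint := by
  obtain ⟨X, hX⟩ := h
  let Y : E →L[ℂ] E := X.symm.toContinuousLinearMap.adjoint
  let Z : E →L[ℂ] E := X.toContinuousLinearMap.adjoint
  have hYZ : Y ∘L Z = .id ℂ E := by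
    rw [← ContinuousLinearMap.adjoint_comp, X.coe_comp_coe_symm, ContinuousLinearMap.adjoint_id]
  have hZY : Z ∘L Y = .id ℂ E := by
    rw [← ContinuousLinearMap.adjoint_comp, X.coe_symm_comp_coe, ContinuousLinearMap.adjoint_id]
  refine ⟨.equivOfInverse' Y Z hYZ hZY, ?_⟩
  have hinter : X.symm.toContinuousLinearMap ∘L S = T ∘L X.symm.toContinuousLinearMap := by
    ext y
    simpa using congrArg (fun A : E →L[ℂ] E => X.symm (A (X.symm y))) hX
  change S.adjoint ∘L Y = Y ∘L T.adjoint
  rw [← ContinuousLinearMap.adjoint_comp, hinter, ContinuousLinearMap.adjoint_comp]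

theorem IsCalculus.adjoint (h : IsCalculus φ T S) (hφ : DifferentiableOn ℂ φ disk) :
    IsCalculus (fun z => star (φ (star z))) T.adjoint S.adjoint := by
  refine h.star.congr_fun fun k => ?_
  rw [coeff_star_conj hφ, star_smul, star_pow]
  rfl

theorem WeaklyHomogeneous.adjoint (hT : WeaklyHomogeneous T) : WeaklyHomogeneous T.adjoint := by
  refine ⟨fun z hz => ?_, fun φ hφ => ?_⟩
  · rw [← ContinuousLinearMap.star_eq_adjoint, spectrum.map_star] at hz
    simpa using hT.1 hz
  · obtain ⟨S, hS, hsim⟩ := hT.2 _ hφ.star_conj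
    refine ⟨S.adjoint, ?_, hsim.adjoint⟩
    simpa only [star_star] using hS.adjoint hφ.star_conj.1

end Adjoint

/-! ### The adjoint of the block operator -/

section Block

variable {α β : Weight} {h φ : ℂ → ℂ}

theorem adjoint_blockOp_apply (hh : h ∈ Mult α β) (x : WithLp 2 (HardySpace α × HardySpace β)) :
    (blockOp α β h hh).adjoint x =
      WithLp.toLp 2 (shift α x.fst, mulOp α β h hh x.fst + shift β x.snd) := by
  refine ext_inner_right ℂ fun y => ?_
  have hy : blockOp α β h hh y = WithLp.toLp 2 ((shift α).adjoint y.fst +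
      (mulOp α β h hh).adjoint y.snd, (shift β).adjoint y.snd) := rfl
  rw [ContinuousLinearMap.adjoint_inner_left, hy, WithLp.prod_inner_apply,
    WithLp.prod_inner_apply]
  simp only [inner_add_left, inner_add_right, ContinuousLinearMap.adjoint_inner_right, add_assoc]
  rfl

theorem adjoint_blockOp_pow_apply (hh : h ∈ Mult α β)
    (x : WithLp 2 (HardySpace α × HardySpace β)) (k : ℕ) (z : ℂ) :
    (((blockOp α β h hh).adjoint ^ k) x).fst z = z ^ k * x.fst z ∧
      (((blockOp α β h hh).adjoint ^ k) x).snd z =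
        k * z ^ (k - 1) * (h z * x.fst z) + z ^ k * x.snd z := by
  induction k with
  | zero => simp
  | succ k ih =>
    rw [pow_succ', mul_apply_eq_comp, adjoint_blockOp_apply]
    constructor
    · rw [WithLp.toLp_fst, shift_apply, ih.1]
      ring
    · rw [WithLp.toLp_snd, HardySpace.add_apply, mulOp_apply, shift_apply, ih.1, ih.2]
      rcases k with _ | k
      · simp
      · push_cast [Nat.add_sub_cancel]
        ring

theorem IsCalculus.adjoint_blockOp_apply {hh : h ∈ Mult α β}
    {S : WithLp 2 (HardySpace α × HardySpace β) →L[ℂ] WithLp 2 (HardySpace α × HardySpace β)}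
    (hS : IsCalculus φ (blockOp α β h hh).adjoint S) (hφ : DifferentiableOn ℂ φ disk)
    (x : WithLp 2 (HardySpace α × HardySpace β)) {z : ℂ} (hz : z ∈ disk) :
    (S x).fst z = φ z * x.fst z ∧
      (S x).snd z = deriv φ z * (h z * x.fst z) + φ z * x.snd z := by
  have hx := hS.mapL (ContinuousLinearMap.apply ℂ _ x)
  constructor
  · refine (hx.mapL (evalAt α hz ∘L WithLp.fstL 2 ℂ _ _)).unique
      (((hasSum_coeff hφ hz).mul_right (x.fst z)).congr_fun fun k => ?_)
    change coeff φ k * (((blockOp α β h hh).adjoint ^ k) x).fst z = _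
    rw [(adjoint_blockOp_pow_apply hh x k z).1, mul_assoc]
  · refine (hx.mapL (evalAt β hz ∘L WithLp.sndL 2 ℂ _ _)).unique
      ((((hasSum_deriv hφ hz).mul_right (h z * x.fst z)).add
        ((hasSum_coeff hφ hz).mul_right (x.snd z))).congr_fun fun k => ?_)
    change coeff φ k * (((blockOp α β h hh).adjoint ^ k) x).snd z = _
    rw [(adjoint_blockOp_pow_apply hh x k z).2]
    ring

/-- The inclusion `f ↦ (f, 0)` of the first summand of the Hilbert space direct sum. -/
def inlL (α β : Weight) : HardySpace α →L[ℂ] WithLp 2 (HardySpace α × HardySpace β) :=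
  (WithLp.prodContinuousLinearEquiv 2 ℂ _ _).symm.toContinuousLinearMap ∘L
    ContinuousLinearMap.inl ℂ _ _

/-- The inclusion `g ↦ (0, g)` of the second summand of the Hilbert space direct sum. -/
def inrL (α β : Weight) : HardySpace β →L[ℂ] WithLp 2 (HardySpace α × HardySpace β) :=
  (WithLp.prodContinuousLinearEquiv 2 ℂ _ _).symm.toContinuousLinearMap ∘L
    ContinuousLinearMap.inr ℂ _ _

theorem inlL_fst_add_inrL_snd (x : WithLp 2 (HardySpace α × HardySpace β)) :
    inlL α β x.fst + inrL α β x.snd = x :=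
  WithLp.ofLp_injective 2 (Prod.ext (add_zero _) (zero_add _))

theorem adjoint_blockOp_inlL (hh : h ∈ Mult α β) (f : HardySpace α) :
    (blockOp α β h hh).adjoint (inlL α β f) =
      inlL α β (shift α f) + inrL α β (mulOp α β h hh f) := by
  rw [adjoint_blockOp_apply]
  refine (inlL_fst_add_inrL_snd _).symm.trans ?_
  change inlL α β (shift α f) + inrL α β (mulOp α β h hh f + shift β 0) = _
  rw [map_zero, add_zero]

theorem adjoint_blockOp_inrL (hh : h ∈ Mult α β) (g : HardySpace β) :
    (blockOp α β h hh).adjoint (inrL α β g) = inrL α β (shift β g) := by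
  rw [adjoint_blockOp_apply]
  refine (inlL_fst_add_inrL_snd _).symm.trans ?_
  change inlL α β (shift α 0) + inrL α β (mulOp α β h hh 0 + shift β g) = _
  rw [map_zero, map_zero, map_zero, zero_add, zero_add]

end Block

/-! ### Intertwiners of the block operator -/

/-- The entries of a `2 × 2` operator matrix `V` with surjective first row such that
`V A = φ(A) V`, where `A = [[M_z, 0], [M_h, M_z]]` is the adjoint of `blockOp α β h hh` and
`φ(A) = [[M_φ, 0], [M_{φ'h}, M_φ]]`. Each equation is one entry of this identity, evaluated
pointwise, so that no multiplication operator by `φ` or `φ'` is needed. -/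
structure BlockIntertwiner (α β : Weight) (h : ℂ → ℂ) (hh : h ∈ Mult α β) (φ : ℂ → ℂ) where
  V₁₁ : HardySpace α →L[ℂ] HardySpace α
  V₁₂ : HardySpace β →L[ℂ] HardySpace α
  V₂₁ : HardySpace α →L[ℂ] HardySpace β
  V₂₂ : HardySpace β →L[ℂ] HardySpace β
  entry₁₁ : ∀ f, ∀ z ∈ disk, V₁₁ (shift α f) z + V₁₂ (mulOp α β h hh f) z = φ z * V₁₁ f z
  entry₁₂ : ∀ g, ∀ z ∈ disk, V₁₂ (shift β g) z = φ z * V₁₂ g z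
  entry₂₁ : ∀ f, ∀ z ∈ disk, V₂₁ (shift α f) z + V₂₂ (mulOp α β h hh f) z =
    deriv φ z * (h z * V₁₁ f z) + φ z * V₂₁ f z
  entry₂₂ : ∀ g, ∀ z ∈ disk, V₂₂ (shift β g) z =
    deriv φ z * (h z * V₁₂ g z) + φ z * V₂₂ g z
  exists_row₁_eq : ∀ f, ∃ g k, V₁₁ g + V₁₂ k = f

theorem WeaklyHomogeneous.nonempty_blockIntertwiner {α β : Weight} {h φ : ℂ → ℂ}
    {hh : h ∈ Mult α β} (hT : WeaklyHomogeneous (blockOp α β h hh)) (hφ : IsDiskAut φ) :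
    Nonempty (BlockIntertwiner α β h hh φ) := by
  obtain ⟨S, hS, V, hV⟩ := hT.adjoint.2 φ hφ
  have hSV : ∀ x, S (V x) = V ((blockOp α β h hh).adjoint x) := fun x =>
    congrArg (fun A : _ →L[ℂ] _ => A x) hV
  have hVz := fun x z (hz : z ∈ disk) => hS.adjoint_blockOp_apply hφ.1 (V x) hz
  simp only [hSV] at hVz
  have hinl := fun f => hVz (inlL α β f)
  have hinr := fun g => hVz (inrL α β g)
  simp only [adjoint_blockOp_inlL, map_add] at hinl
  simp only [adjoint_blockOp_inrL] at hinr
  let fst := WithLp.fstL 2 ℂ (HardySpace α) (HardySpace β)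
  let snd := WithLp.sndL 2 ℂ (HardySpace α) (HardySpace β)
  exact ⟨{
    V₁₁ := fst ∘L V.toContinuousLinearMap ∘L inlL α β
    V₁₂ := fst ∘L V.toContinuousLinearMap ∘L inrL α β
    V₂₁ := snd ∘L V.toContinuousLinearMap ∘L inlL α β
    V₂₂ := snd ∘L V.toContinuousLinearMap ∘L inrL α β
    entry₁₁ := fun f z hz => (hinl f z hz).1
    entry₁₂ := fun g z hz => (hinr g z hz).1
    entry₂₁ := fun f z hz => (hinl f z hz).2
    entry₂₂ := fun g z hz => (hinr g z hz).2
    exists_row₁_eq := fun f => by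
      obtain ⟨x, hx⟩ := V.surjective (inlL α β f)
      refine ⟨x.fst, x.snd, ?_⟩
      rw [← inlL_fst_add_inrL_snd x, map_add] at hx
      exact congrArg WithLp.fst hx }⟩

namespace BlockIntertwiner

variable {α β : Weight} {h φ : ℂ → ℂ} {hh : h ∈ Mult α β} (V : BlockIntertwiner α β h hh φ)
include V

theorem isWeightedComp_V₁₂ (hφ : MapsTo φ disk disk) :
    IsWeightedComp V.V₁₂ (V.V₁₂ (monomial β 0)) φ :=
  isWeightedComp_of_apply_shift_eq hφ V.entry₁₂

theorem V₁₂_eq_zero (hα : MobiusInvariant α) (hφ : IsDiskAut φ) (h0 : ∃ z ∈ disk, h z ≠ 0) :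
    V.V₁₂ = 0 := by
  have hV := V.isWeightedComp_V₁₂ hφ.2.mapsTo
  generalize V.V₁₂ (monomial β 0) = p at hV
  have hhφ : DifferentiableOn ℂ (h ∘ φ) disk := hh.1.comp hφ.1 hφ.2.mapsTo
  have hmul : EqOn (fun z => -(p z * (h ∘ φ) z)) 0 disk :=
    eqOn_zero_of_apply_shift_eq hα α.tendsto_div_nat_mul_self hφ (p.mem.1.mul hhφ).neg
      fun f z hz => by
        have hz' := V.entry₁₁ f z hz
        rw [hV _ z hz, mulOp_apply] at hz'
        rw [Function.comp_apply]
        linear_combination hz'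
  have hp : EqOn p 0 disk :=
    (AnalyticOnNhd.eq_zero_or_eq_zero_of_mul_eq_zero (p.mem.1.analyticOnNhd isOpen_disk)
      (hhφ.analyticOnNhd isOpen_disk) (fun z hz => neg_eq_zero.1 (hmul hz))
      (convex_ball (0 : ℂ) 1).isPreconnected).resolve_right fun hzero => by
        obtain ⟨w, hw, hhw⟩ := h0
        obtain ⟨z, hz, rfl⟩ := hφ.2.surjOn hw
        exact hhw (hzero z hz)
  ext g
  refine HardySpace.ext fun z hz => ?_
  rw [hV g z hz, hp hz]
  exact zero_mul _

theorem isWeightedComp_V₁₁ (hφ : MapsTo φ disk disk) (hV : V.V₁₂ = 0) :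
    IsWeightedComp V.V₁₁ (V.V₁₁ (monomial α 0)) φ :=
  isWeightedComp_of_apply_shift_eq hφ fun f z hz => by
    rw [← V.entry₁₁ f z hz, hV]
    exact (add_zero _).symm

theorem isWeightedComp_V₂₂ (hφ : MapsTo φ disk disk) (hV : V.V₁₂ = 0) :
    IsWeightedComp V.V₂₂ (V.V₂₂ (monomial β 0)) φ :=
  isWeightedComp_of_apply_shift_eq hφ fun g z hz => by
    have hzero : V.V₁₂ g z = 0 := by rw [hV]; rfl
    rw [V.entry₂₂ g z hz, hzero, mul_zero, mul_zero, zero_add]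

theorem surjective_V₁₁ (hV : V.V₁₂ = 0) : Function.Surjective V.V₁₁ := fun f => by
  obtain ⟨g, k, hgk⟩ := V.exists_row₁_eq f
  exact ⟨g, by rwa [hV, zero_apply, add_zero] at hgk⟩

theorem deriv_mul_eq (hβ : MobiusInvariant β)
    (hαβ : Tendsto (fun k : ℕ => α k / ((k : ℝ) * β k)) atTop (𝓝 0)) (hφ : IsDiskAut φ)
    {r q : ℂ → ℂ} (hr : IsWeightedComp V.V₁₁ r φ) (hq : IsWeightedComp V.V₂₂ q φ)
    (hrd : DifferentiableOn ℂ r disk) (hqd : DifferentiableOn ℂ q disk) :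
    EqOn (fun z => deriv φ z * (h z * r z)) (fun z => q z * h (φ z)) disk := by
  have hzero : EqOn (fun z => deriv φ z * (h z * r z) - q z * (h ∘ φ) z) 0 disk :=
    eqOn_zero_of_apply_shift_eq (L := V.V₂₁) hβ hαβ hφ
      (((hφ.1.deriv isOpen_disk).mul (hh.1.mul hrd)).sub
        (hqd.mul (hh.1.comp hφ.1 hφ.2.mapsTo))) fun f z hz => by
      have hz' := V.entry₂₁ f z hz
      rw [hr f z hz, hq _ z hz, mulOp_apply] at hz'
      rw [Function.comp_apply]
      linear_combination hz'
  exact fun z hz => sub_eq_zero.1 (hzero hz)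

theorem exists_norm_deriv_mul_le (hα : MobiusInvariant α) (hβ : MobiusInvariant β)
    (hαβ : Tendsto (fun k : ℕ => α k / ((k : ℝ) * β k)) atTop (𝓝 0)) (hφ : IsDiskAut φ)
    (hV : V.V₁₂ = 0) : ∃ C : ℝ, ∀ z ∈ disk, ‖deriv φ z‖ * ‖h z‖ ≤ C * ‖h (φ z)‖ := by
  have hr := V.isWeightedComp_V₁₁ hφ.2.mapsTo hV
  have hq := V.isWeightedComp_V₂₂ hφ.2.mapsTo hV
  have hsurj := V.surjective_V₁₁ hV
  have heq := V.deriv_mul_eq hβ hαβ hφ hr hq (HardySpace.mem _).1 (HardySpace.mem _).1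
  generalize V.V₁₁ (monomial α 0) = r at hr heq
  generalize V.V₂₂ (monomial β 0) = q at hq heq
  have hrinv := hr.inv_mem_mult hα hφ hsurj
  have hqmul := hq.mem_mult hβ hφ
  refine ⟨‖mulOp α α _ hrinv‖ * ‖mulOp β β _ hqmul‖, fun z hz => ?_⟩
  have hquot : deriv φ z * h z = (r z)⁻¹ * q z * h (φ z) := by
    have hz' : deriv φ z * (h z * r z) = q z * h (φ z) := heq hz
    rw [mul_assoc, ← hz', ← mul_assoc (deriv φ z), mul_comm _ (r z),
      inv_mul_cancel_left₀ (hr.ne_zero hsurj hz)]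
  calc ‖deriv φ z‖ * ‖h z‖ = ‖(r z)⁻¹‖ * ‖q z‖ * ‖h (φ z)‖ := by
        rw [← norm_mul, hquot, norm_mul, norm_mul]
    _ ≤ ‖mulOp α α _ hrinv‖ * ‖mulOp β β _ hqmul‖ * ‖h (φ z)‖ := by
        gcongr
        · exact norm_apply_le_norm_mulOp hrinv hz
        · exact norm_apply_le_norm_mulOp hqmul hz

end BlockIntertwiner

/-! ### Quasi-invariant functions -/

/-- `|φ'| |h| ≤ C |h ∘ φ|` on the disk for each automorphism `φ`, with `C` depending on `φ`: up to
bounded factors, `h` transforms like a form of weight one. -/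
def IsQuasiInvariant (h : ℂ → ℂ) : Prop :=
  ∀ φ, IsDiskAut φ → ∃ C : ℝ, ∀ z ∈ disk, ‖deriv φ z‖ * ‖h z‖ ≤ C * ‖h (φ z)‖

theorem WeaklyHomogeneous.isQuasiInvariant {α β : Weight} (hα : MobiusInvariant α)
    (hβ : MobiusInvariant β)
    (hαβ : Tendsto (fun k : ℕ => α k / ((k : ℝ) * β k)) atTop (𝓝 0)) {h : ℂ → ℂ}
    {hh : h ∈ Mult α β} (hT : WeaklyHomogeneous (blockOp α β h hh)) : IsQuasiInvariant h := by
  intro φ hφ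
  by_cases h0 : ∃ z ∈ disk, h z ≠ 0
  · obtain ⟨V⟩ := hT.nonempty_blockIntertwiner hφ
    exact V.exists_norm_deriv_mul_le hα hβ hαβ hφ (V.V₁₂_eq_zero hα hφ h0)
  · push Not at h0
    exact ⟨0, fun z hz => by simp [h0 z hz]⟩

namespace IsQuasiInvariant

variable {h : ℂ → ℂ}

theorem eqOn_zero_of_mem_disk (hq : IsQuasiInvariant h) {z : ℂ} (hz : z ∈ disk)
    (hhz : h z = 0) : EqOn h 0 disk := by
  intro w hw
  obtain ⟨φ, hφ, rfl⟩ := exists_isDiskAut_apply_eq hw hz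
  obtain ⟨C, hC⟩ := hq φ hφ
  have hle := hC w hw
  rw [hhz, norm_zero, mul_zero, ← norm_mul, norm_le_zero_iff] at hle
  exact (mul_eq_zero.1 hle).resolve_left (hφ.deriv_ne_zero hw)

theorem exists_norm_le_rotation (hq : IsQuasiInvariant h) (hcont : ContinuousOn h closedDisk)
    {c : ℂ} (hc : ‖c‖ = 1) : ∃ C : ℝ, ∀ z ∈ closedDisk, ‖h z‖ ≤ C * ‖h (c * z)‖ := by
  obtain ⟨C, hC⟩ := hq _ (isDiskAut_const_mul hc)
  have hm : MapsTo (c * ·) closedDisk closedDisk := fun z hz => by simpa [hc] using hz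
  rw [← closure_disk] at hcont hm ⊢
  have hright : ContinuousOn (fun z => C * ‖h (c * z)‖) (closure disk) :=
    continuousOn_const.mul (hcont.comp (by fun_prop) hm).norm
  refine ⟨C, fun z hz => le_on_closure (fun w hw => ?_) hcont.norm hright hz⟩
  have hderiv : deriv (c * ·) w = c := by simp
  simpa only [hderiv, hc, one_mul] using hC w hw

theorem eqOn_zero_of_mem_sphere (hq : IsQuasiInvariant h) (hcont : ContinuousOn h closedDisk)
    (hd : DifferentiableOn ℂ h disk) {z : ℂ} (hz : ‖z‖ = 1) (hhz : h z = 0) :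
    EqOn h 0 disk := by
  have hsphere : EqOn h 0 (frontier disk) := by
    intro w hw
    rw [frontier_ball 0 one_ne_zero, mem_sphere_zero_iff_norm] at hw
    have hw0 : w ≠ 0 := norm_ne_zero_iff.1 (hw.trans_ne one_ne_zero)
    have hc : ‖z / w‖ = 1 := by rw [norm_div, hz, hw, div_one]
    obtain ⟨C, hC⟩ := hq.exists_norm_le_rotation hcont hc
    have hle := hC w (mem_closedBall_zero_iff.2 hw.le)
    rwa [div_mul_cancel₀ z hw0, hhz, norm_zero, mul_zero, norm_le_zero_iff] at hle
  exact Complex.eqOn_of_eqOn_frontier Metric.isBounded_ball ⟨hd, by rwa [closure_disk]⟩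
    diffContOnCl_const hsphere

theorem eqOn_zero_of_mem_closedDisk (hq : IsQuasiInvariant h)
    (hcont : ContinuousOn h closedDisk) (hd : DifferentiableOn ℂ h disk) {z : ℂ}
    (hz : z ∈ closedDisk) (hhz : h z = 0) : EqOn h 0 closedDisk := by
  have hdisk : EqOn h 0 disk := by
    rcases (mem_closedBall_zero_iff.1 hz).lt_or_eq with hlt | heq
    · exact hq.eqOn_zero_of_mem_disk (mem_ball_zero_iff.2 hlt) hhz
    · exact hq.eqOn_zero_of_mem_sphere hcont hd heq hhz
  exact hdisk.of_subset_closure hcont continuousOn_const Metric.ball_subset_closedBall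
    closure_disk.ge

end IsQuasiInvariant

end

end WeightedHardy

theorem mainTheorem5 (α β : WeightedHardy.Weight)
    (hα : WeightedHardy.MobiusInvariant α) (hβ : WeightedHardy.MobiusInvariant β)
    (hαβ : Tendsto (fun k : ℕ => α k / ((k : ℝ) * β k)) atTop (𝓝 0))
    (h : ℂ → ℂ) (hcont : ContinuousOn h WeightedHardy.closedDisk)
    (hmult : h ∈ WeightedHardy.Mult α β)
    (hT : WeightedHardy.WeaklyHomogeneous (WeightedHardy.blockOp α β h hmult)) :
    (∀ z ∈ WeightedHardy.closedDisk, h z = 0) ∨ (∀ z ∈ WeightedHardy.closedDisk, h z ≠ 0) := by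
  have hq : WeightedHardy.IsQuasiInvariant h := hT.isQuasiInvariant hα hβ hαβ
  by_cases hzero : ∃ z ∈ WeightedHardy.closedDisk, h z = 0
  · obtain ⟨z, hz, hhz⟩ := hzero
    exact .inl (hq.eqOn_zero_of_mem_closedDisk hcont hmult.1 hz hhz)
  · push Not at hzero
    exact .inr hzero
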